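/- Let $n,m\ge 1$, and let $\mathbf{x}_1,\dots,\mathbf{x}_m\in\mathbb{R}_{>0}^n$, where $\mathbf{x}_p=(x_p^{(1)},\dots,x_p^{(n)})$ and upper indices are taken modulo $n$. **The birational $R$-matrix.** For $\mathbf{a},\mathbf{b}\in\mathbb{R}_{>0}^n$ put \[\kappa_r(\mathbf{a},\mathbf{b})=\sum_{s=0}^{n-1}\ \prod_{t=1}^{s}b_{r+t}\prod_{t=s+1}^{n-1}a_{r+t},\qquad a'_r=\frac{a_{r-1}\,\kappa_{r-1}(\mathbf a,\mathbf b)}{\kappa_r(\mathbf a,\mathbf b)},\qquad b'_r=\frac{b_{r+1}\,\kappa_{r+1}(\mathbf a,\mathbf b)}{\kappa_r(\mathbf a,\mathbf b)},\] and $\eta(\mathbf{a},\mathbf{b})=(\mathbf{b}',\mathbf{a}')$. The simple transposition $s_p=(p\ \ p{+}1)$, $1\le p<m$, acts on $(\mathbf{x}_1,\dots,\mathbf{x}_m)$ by replacing the pair $(\mathbf{x}_p,\mathbf{x}_{p+1})$ by $\eta(\mathbf{x}_p,\mathbf{x}_{p+1})$. A product of simple transpositions acts by the composite map, and $s(x_k^{(r)})$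 denotes the $r$-th coordinate of the $k$-th vector of $s(\mathbf{x}_1,\dots,\mathbf{x}_m)$. **The functions $\tau,\sigma,\bar\sigma,\Omega$.** For $d\ge 0$ let \[\tau_d^{(r)}(\mathbf{x}_a,\dots,\mathbf{x}_b)=\sum x_{p_1}^{(r)}x_{p_2}^{(r-1)}\cdots x_{p_d}^{(r-d+1)},\] the sum over all $a\le p_1\le p_2\le\dots\le p_d\le b$ in which no index appears more than $n-1$ times (so $\tau_0^{(r)}=1$; for an empty list of vectors $\tau_d^{(r)}=0$ if $d>0$). Let \[\sigma_d^{(r)}(\mathbf{x}_a,\dots,\mathbf{x}_b)=\sum_{c=0}^{d}x_a^{(r)}x_a^{(r-1)}\cdots x_a^{(r-c+1)}\,\tau_{d-c}^{(r-c)}(\mathbf{x}_{a+1},\dots,\mathbf{x}_b),\] \[\bar\sigma_d^{(r)}(\mathbf{x}_a,\dots,\mathbf{x}_b)=\sum_{c=0}^{d}\tau_{d-c}^{(r)}(\mathbf{x}_a,\dots,\mathbf{x}_{b-1})\,x_b^{(r-d+c)}x_b^{(r-d+c-1)}\cdots x_b^{(r-d+1)},\] and, for $i\le k\le j-1$, \[\Omega_k^{(r)}=\Omega_k^{(r)}(\mathbf{x}_i,\dots,\mathbf{x}_j)=\sum_{\ell=0}^{n-1}\sigma^{(r)}_{(n-1)(k-i)+\ell}(\mathbf{x}_i,\dots,\mathbf{x}_k)\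 \bar\sigma^{(r+k-i-\ell)}_{(n-1)(j-k)-\ell}(\mathbf{x}_{k+1},\dots,\mathbf{x}_j).\] **Theorem.** Let $1\le i<k<j\le m$ and let $r$ be an index modulo $n$. In the symmetric group $S_m$ the product $s_is_{i+1}\cdots s_{j-2}s_{j-1}s_{j-2}\cdots s_{i+1}s_i$ is the transposition $(i\ j)$. The factors $\Omega_{k-1}^{(r-k+i)}$ and $\Omega_k^{(r-k+i-1)}$ are positive, and \[s_i\cdots s_{j-2}s_{j-1}s_{j-2}\cdots s_i\,(x_k^{(r)})=x_k^{(r)}\,\frac{\Omega_k^{(r-k+i)}\ \Omega_{k-1}^{(r-k+i-1)}}{\Omega_{k-1}^{(r-k+i)}\ \Omega_k^{(r-k+i-1)}},\] where all $\Omega$ are functions of $\mathbf{x}_i,\dots,\mathbf{x}_j$. -/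

import Mathlib

/-!  Vectors with `n` coordinates have type `ZMod n → ℝ`: the upper index is taken modulo `n`.
An `m`-tuple of vectors has type `Fin m → ZMod n → ℝ`, so the lower index runs from `0` to
`m - 1`; all formulas below involve lower indices only through differences and order. -/

noncomputable section

namespace BirationalR

/-- `κ_r(a, b) = ∑_{s=0}^{n-1} (b_{r+1} ⋯ b_{r+s}) (a_{r+s+1} ⋯ a_{r+n-1})`. -/
def kappa {n : ℕ} (a b : ZMod n → ℝ) (r : ZMod n) : ℝ :=
  ∑ s ∈ Finset.range n,
    (∏ t ∈ Finset.Icc 1 s, b (r + (t : ZMod n))) *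
      ∏ t ∈ Finset.Icc (s + 1) (n - 1), a (r + (t : ZMod n))

/-- The birational `R`-matrix `η(a, b) = (b', a')`, where
`a'_r = a_{r-1} κ_{r-1} / κ_r` and `b'_r = b_{r+1} κ_{r+1} / κ_r`. -/
def eta {n : ℕ} (a b : ZMod n → ℝ) : (ZMod n → ℝ) × (ZMod n → ℝ) :=
  (fun r => b (r + 1) * kappa a b (r + 1) / kappa a b r,
   fun r => a (r - 1) * kappa a b (r - 1) / kappa a b r)

/-- The action of the simple transposition `s_a` on `m`-tuples: `η` is applied to the entries in
positions `a` and `a + 1`. (Only `a + 1 < m` matters; otherwise nothing is done.) -/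
def simpleAct {n m : ℕ} (a : ℕ) (x : Fin m → ZMod n → ℝ) : Fin m → ZMod n → ℝ :=
  if h : a + 1 < m then
    fun p =>
      if p.val = a then (eta (x ⟨a, by omega⟩) (x ⟨a + 1, h⟩)).1
      else if p.val = a + 1 then (eta (x ⟨a, by omega⟩) (x ⟨a + 1, h⟩)).2
      else x p
  else x

/-- The simple transposition `s_a = (a  a+1)` as an element of the symmetric group
(only `a + 1 < m` matters). -/
def simplePerm {m : ℕ} (a : ℕ) : Equiv.Perm (Fin m) :=
  if h : a + 1 < m then Equiv.swap ⟨a, by omega⟩ ⟨a + 1, h⟩ else 1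

/-- The action of a product `s_{a₁} s_{a₂} ⋯ s_{a_p}` on `m`-tuples, the composite of the maps
by which the factors act (the rightmost factor acts first). -/
def wordAct {n m : ℕ} (w : List ℕ) (x : Fin m → ZMod n → ℝ) : Fin m → ZMod n → ℝ :=
  w.foldr simpleAct x

/-- The product `s_{a₁} s_{a₂} ⋯ s_{a_p}` in the symmetric group. -/
def wordPerm {m : ℕ} (w : List ℕ) : Equiv.Perm (Fin m) :=
  (w.map simplePerm).prod

/-- The word `s_i s_{i+1} ⋯ s_{j-2} s_{j-1} s_{j-2} ⋯ s_{i+1} s_i`, for `i < j`. -/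
def transWord (i j : ℕ) : List ℕ :=
  List.range' i (j - 1 - i) ++ [j - 1] ++ (List.range' i (j - 1 - i)).reverse

open Classical in
/-- `τ_k^{(r)}` of the vectors `x_p`, `p ∈ S`, in increasing order of `p`: the sum over weakly
increasing sequences `p_0 ≤ p_1 ≤ ⋯ ≤ p_{k-1}` in `S`, in which no index appears more than
`n - 1` times, of `x_{p_0}^{(r)} x_{p_1}^{(r-1)} ⋯ x_{p_{k-1}}^{(r-k+1)}`. -/
def tau {n m : ℕ} (x : Fin m → ZMod n → ℝ) (S : Finset (Fin m)) (k : ℕ) (r : ZMod n) : ℝ :=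
  ∑ p : Fin k → Fin m with
      Monotone p ∧ (∀ t, p t ∈ S) ∧
        ∀ q : Fin m, (Finset.univ.filter fun t => p t = q).card ≤ n - 1,
    ∏ t : Fin k, x (p t) (r - ((t : ℕ) : ZMod n))

/-- `σ_d^{(r)}(x_i, …, x_k)
  = ∑_{a=0}^{d} x_i^{(r)} x_i^{(r-1)} ⋯ x_i^{(r-a+1)} τ_{d-a}^{(r-a)}(x_{i+1}, …, x_k)`,
for `i ≤ k`. -/
def sigma {n m : ℕ} (x : Fin m → ZMod n → ℝ) (i k : Fin m) (d : ℕ) (r : ZMod n) : ℝ :=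
  ∑ a ∈ Finset.range (d + 1),
    (∏ t ∈ Finset.range a, x i (r - (t : ZMod n))) *
      tau x (Finset.Ioc i k) (d - a) (r - (a : ZMod n))

/-- `σ̄_d^{(r)}(x_{k+1}, …, x_j)
  = ∑_{a=0}^{d} τ_{d-a}^{(r)}(x_{k+1}, …, x_{j-1}) x_j^{(r-d+a)} x_j^{(r-d+a-1)} ⋯ x_j^{(r-d+1)}`,
for `k < j`. The index `k` in the arguments is the one just before the first vector. -/
def sigmaBar {n m : ℕ} (x : Fin m → ZMod n → ℝ) (k j : Fin m) (d : ℕ) (r : ZMod n) : ℝ :=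
  ∑ a ∈ Finset.range (d + 1),
    tau x (Finset.Ioo k j) (d - a) r *
      ∏ t ∈ Finset.range a, x j (r - (d : ZMod n) + (a : ZMod n) - (t : ZMod n))

/-- `Ω_k^{(r)}(x_i, …, x_j) = ∑_{ℓ=0}^{n-1} σ_{(n-1)(k-i)+ℓ}^{(r)}(x_i, …, x_k)
  σ̄_{(n-1)(j-k)-ℓ}^{(r+k-i-ℓ)}(x_{k+1}, …, x_j)`, for `i ≤ k < j`; for these `i, k, j` no
subtraction of natural numbers below is truncated. -/
def Omega {n m : ℕ} (x : Fin m → ZMod n → ℝ) (i k j : Fin m) (r : ZMod n) : ℝ :=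
  ∑ l ∈ Finset.range n,
    sigma x i k ((n - 1) * (k.val - i.val) + l) r *
      sigmaBar x k j ((n - 1) * (j.val - k.val) - l)
        (r + (k.val : ZMod n) - (i.val : ZMod n) - (l : ZMod n))

/-- The index `k - 1`, for `0 < k`. -/
def prev {m : ℕ} (k : Fin m) : Fin m := ⟨k.val - 1, by omega⟩

end BirationalR

end

/-!
The idea is to factor the transposition through vectors that are moved across the whole tuple.

With `T` the operator lowering the upper index by one, `η` leaves `(1 - bT)(1 - aT)` unchanged and
exchanges the products of the entries of `a` and `b` around the cycle (`eta_add`, `eta_mul`,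
`descProd_eta_fst`). For positive vectors the rightmost factor of `(1 - cT)(1 - bT)(1 - aT)` is
determined by the product and by `∏ a` (`LoopEq.fst_eq`), and this gives the first component of the
Yang–Baxter equation (`eta_yangBaxter_fst`).

Let `w_p` be `x_i` moved right past `x_{i+1}, …, x_p`, and `u_p` be `x_j` moved left past
`x_{j-1}, …, x_p`. By induction on `j - i` and the Yang–Baxter equation, the `k`-th vector of the
result is the second component of `η(η(w_{k-1}, x_k)₁, η(w_k, u_{k+1})₁)`
(`extend_wordAct_transWord`), and the first component of the same pair is `η(w_{k-1}, u_k)₁`. Since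
`η` preserves the products `a_{r-1} b_r`, the `k`-th vector is therefore a ratio of entries of
`w_{k-1}`, `w_k`, `η(w_k, u_{k+1})₁` and `η(w_{k-1}, u_k)₁`.

All of these are explicit. For the twisted convolution `conv`, `τ` of a disjoint union of an initial
and a final segment is a product (`tau_union`), so that `σ` and `σ̄` obey one-step recursions
(`sigma_succ`, `sigmaBar_pred`). By these, `w_p` and `u_p` are ratios of values of `σ` and `σ̄` in
the top degree of the truncated factors (`moveRight_formula`, `moveLeft_formula`). Products of
consecutive entries telescope, because above that degree `σ` and `σ̄` only collect further entries
of `x_i` and `x_j` (`sigma_add`, `sigmaBar_add`). Hence `κ(w_k, u_{k+1})` is `Ω_k` up to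
normalization (`kappa_moveRight_moveLeft`), and in the final ratio everything but `x_k` and the
`Ω`'s cancels.
-/

noncomputable section

namespace BirationalR

open Finset

/-! ### Descending products and twisted convolution -/

/-- The descending product `a^{(r)} a^{(r-1)} ⋯ a^{(r-l+1)}` of `l` factors. -/
def descProd {n : ℕ} (a : ZMod n → ℝ) (l : ℕ) (r : ZMod n) : ℝ :=
  ∏ t ∈ range l, a (r - (t : ZMod n))

theorem descProd_zero {n : ℕ} (a : ZMod n → ℝ) (r : ZMod n) : descProd a 0 r = 1 := by
  simp [descProd]

theorem descProd_add {n : ℕ} (a : ZMod n → ℝ) (k l : ℕ) (r : ZMod n) :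
    descProd a (k + l) r = descProd a k r * descProd a l (r - (k : ZMod n)) := by
  simp only [descProd, prod_range_add, Nat.cast_add, sub_sub]

theorem descProd_one {n : ℕ} (a : ZMod n → ℝ) (r : ZMod n) : descProd a 1 r = a r := by
  simp [descProd]

theorem descProd_mul {n : ℕ} (a b : ZMod n → ℝ) (l : ℕ) (r : ZMod n) :
    descProd (fun s => a s * b s) l r = descProd a l r * descProd b l r := by
  simp only [descProd, prod_mul_distrib]

theorem descProd_shift {n : ℕ} (a : ZMod n → ℝ) (c : ZMod n) (l : ℕ) (r : ZMod n) :
    descProd (fun s => a (s + c)) l r = descProd a l (r + c) := by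
  simp only [descProd]
  exact prod_congr rfl fun t _ => by ring_nf

/-- A product of ratios of consecutive values telescopes. -/
theorem descProd_ratio {n : ℕ} {f : ZMod n → ℝ} (hf : ∀ r, 0 < f r) (l : ℕ) (r : ZMod n) :
    descProd (fun s => f s / f (s - 1)) l r = f r / f (r - (l : ZMod n)) := by
  induction l with
  | zero => simp [descProd, (hf r).ne']
  | succ l ih =>
    rw [descProd_add, ih, descProd_one]
    have h1 := (hf (r - (l : ZMod n))).ne'
    have e : r - (l : ZMod n) - 1 = r - ((l + 1 : ℕ) : ZMod n) := by push_cast; ring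
    rw [e]
    field_simp

/-- The product of `n` consecutive factors runs once around the cycle, so it does not depend on
where it starts. -/
theorem descProd_period {n : ℕ} {a : ZMod n → ℝ} (ha : ∀ r, 0 < a r) (r : ZMod n) :
    descProd a n (r + 1) = descProd a n r := by
  have h1 := descProd_add a n 1 (r + 1)
  have h2 := descProd_add a 1 n (r + 1)
  rw [add_comm 1 n, h1, descProd_one, descProd_one] at h2
  simp only [Nat.cast_one, CharP.cast_eq_zero, sub_zero, add_sub_cancel_right] at h2
  exact mul_right_cancel₀ (ha (r + 1)).ne' (h2.trans (mul_comm _ _))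

/-- The twisted convolution `(f * g)_d^{(r)} = ∑_{a+b=d} f_a^{(r)} g_b^{(r-a)}`: multiplication of
power series in a variable that lowers the upper index by one. -/
def conv {n : ℕ} (f g : ℕ → ZMod n → ℝ) (d : ℕ) (r : ZMod n) : ℝ :=
  ∑ p ∈ antidiagonal d, f p.1 r * g p.2 (r - (p.1 : ZMod n))

theorem conv_assoc {n : ℕ} (f g h : ℕ → ZMod n → ℝ) :
    conv (conv f g) h = conv f (conv g h) := by
  funext d r
  simp only [conv, sum_mul, mul_sum]
  rw [sum_sigma', sum_sigma']
  refine sum_nbij' (fun p => ⟨(p.2.1, p.2.2 + p.1.2), (p.2.2, p.1.2)⟩)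
    (fun p => ⟨(p.1.1 + p.2.1, p.2.2), (p.1.1, p.2.1)⟩) ?_ ?_ ?_ ?_ ?_
  · rintro ⟨⟨a, b⟩, ⟨c, e⟩⟩ h
    simp only [mem_sigma, HasAntidiagonal.mem_antidiagonal] at h ⊢
    obtain ⟨rfl, rfl⟩ := h
    exact ⟨by ring, trivial⟩
  · rintro ⟨⟨a, b⟩, ⟨c, e⟩⟩ h
    simp only [mem_sigma, HasAntidiagonal.mem_antidiagonal] at h ⊢
    obtain ⟨rfl, rfl⟩ := h
    exact ⟨by ring, trivial⟩
  · rintro ⟨⟨a, b⟩, ⟨c, e⟩⟩ h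
    simp only [mem_sigma, HasAntidiagonal.mem_antidiagonal] at h ⊢
    obtain ⟨-, rfl⟩ := h
    rfl
  · rintro ⟨⟨a, b⟩, ⟨c, e⟩⟩ h
    simp only [mem_sigma, HasAntidiagonal.mem_antidiagonal] at h ⊢
    obtain ⟨-, rfl⟩ := h
    rfl
  · rintro ⟨⟨a, b⟩, ⟨c, e⟩⟩ h
    simp only [mem_sigma, HasAntidiagonal.mem_antidiagonal] at h ⊢
    obtain ⟨-, rfl⟩ := h
    push_cast
    rw [sub_sub, mul_assoc]

theorem conv_eq_sum_range {n : ℕ} (f g : ℕ → ZMod n → ℝ) (d : ℕ) (r : ZMod n) :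
    conv f g d r = ∑ a ∈ range (d + 1), f a r * g (d - a) (r - (a : ZMod n)) :=
  Nat.sum_antidiagonal_eq_sum_range_succ (fun a b => f a r * g b (r - (a : ZMod n))) d

theorem conv_eq_sum_range_snd {n : ℕ} (f g : ℕ → ZMod n → ℝ) (d : ℕ) (r : ZMod n) :
    conv f g d r =
      ∑ a ∈ range (d + 1), f (d - a) r * g a (r - ((d - a : ℕ) : ZMod n)) := by
  rw [conv, ← Nat.sum_antidiagonal_swap]
  exact Nat.sum_antidiagonal_eq_sum_range_succ (fun a b => f b r * g a (r - (b : ZMod n))) d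

/-! ### The functions tau, sigma and their recursions -/

section Tau

variable {n m : ℕ} (x : Fin m → ZMod n → ℝ)

theorem sigma_eq_conv (i k : Fin m) :
    sigma x i k = conv (descProd (x i)) (tau x (Ioc i k)) := by
  funext d r
  rw [conv_eq_sum_range]
  rfl

theorem sigmaBar_eq_conv (k j : Fin m) :
    sigmaBar x k j = conv (tau x (Ioo k j)) (descProd (x j)) := by
  funext d r
  rw [conv_eq_sum_range_snd]
  refine sum_congr rfl fun a ha => ?_
  rw [Nat.cast_sub (by simpa [Nat.lt_succ_iff] using ha), ← sub_add]
  rfl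

/-- The index sequences over which `tau` sums. -/
structure Admissible (n : ℕ) {m k : ℕ} (S : Finset (Fin m)) (p : Fin k → Fin m) : Prop where
  mono : Monotone p
  mem : ∀ t, p t ∈ S
  card_le : ∀ q, #{t | p t = q} ≤ n - 1

open Classical in
theorem tau_eq (S : Finset (Fin m)) (k : ℕ) (r : ZMod n) :
    tau x S k r = ∑ p : Fin k → Fin m with Admissible n S p,
      ∏ t : Fin k, x (p t) (r - ((t : ℕ) : ZMod n)) := by
  refine sum_congr ?_ fun _ _ => rfl
  ext p
  simp only [mem_filter, mem_univ, true_and]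
  constructor
  · rintro ⟨h1, h2, h3⟩
    exact ⟨h1, h2, fun q => by convert h3 q⟩
  · rintro ⟨h1, h2, h3⟩
    exact ⟨h1, h2, fun q => by convert h3 q⟩

theorem card_filter_append {c e : ℕ} (p : Fin (c + e) → Fin m) (P : Fin m → Prop)
    [DecidablePred P] :
    #{t | P (p t)} = #{t | P (p (Fin.castAdd e t))} + #{t | P (p (Fin.natAdd c t))} := by
  simp only [card_filter, Fin.sum_univ_add]

/-- Sequences in `S₁ ∪ S₂`, with `S₁` below `S₂` and exactly `c` entries in `S₁`, are
concatenations of a sequence of length `c` in `S₁` and a sequence in `S₂`. -/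
theorem admissible_append_iff {S₁ S₂ : Finset (Fin m)} (h : ∀ p ∈ S₁, ∀ q ∈ S₂, p < q)
    {c e : ℕ} (p : Fin (c + e) → Fin m) :
    Admissible n (S₁ ∪ S₂) p ∧ #{t | p t ∈ S₁} = c ↔
      Admissible n S₁ (fun t => p (Fin.castAdd e t)) ∧
        Admissible n S₂ (fun t => p (Fin.natAdd c t)) := by
  have hdisj : ∀ q ∈ S₁, q ∉ S₂ := fun q h1 h2 => lt_irrefl _ (h q h1 q h2)
  constructor
  · rintro ⟨⟨hm, hS, hc⟩, hcard⟩
    -- The entries in `S₁` form an initial segment of length `c`.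
    have key : ∀ t, p t ∈ S₁ ↔ t.val < c := by
      have down : ∀ s t, s ≤ t → p t ∈ S₁ → p s ∈ S₁ := by
        intro s t hst ht
        rcases mem_union.1 (hS s) with h1 | h1
        · exact h1
        · exact absurd (h _ ht _ h1) (not_lt.2 (hm hst))
      intro t
      constructor
      · intro ht
        by_contra hlt
        have hsub : Iic t ⊆ ({t | p t ∈ S₁} : Finset _) := fun s hs => by
          simpa using down s t (mem_Iic.1 hs) ht
        have := card_le_card hsub
        rw [hcard, Fin.card_Iic] at this
        omega
      · intro hlt
        by_contra ht
        have hsub : ({t | p t ∈ S₁} : Finset _) ⊆ Iio t := fun s hs => by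
          rw [mem_Iio]
          by_contra hts
          exact ht (down t s (not_lt.1 hts) (by simpa using hs))
        have := card_le_card hsub
        rw [hcard, Fin.card_Iio] at this
        omega
    refine ⟨⟨fun s t hst => hm (show s.val ≤ t.val from hst), fun t => (key _).2 (by simp),
      fun q => ?_⟩, ⟨fun s t hst => hm (by simpa using hst), fun t => ?_, fun q => ?_⟩⟩
    · have := card_filter_append p (· = q)
      have := hc q
      omega
    · refine (mem_union.1 (hS _)).resolve_left fun h1 => ?_
      have := (key _).1 h1
      simp at this
    · have := card_filter_append p (· = q)
      have := hc q
      omega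
  · rintro ⟨⟨hm1, hS1, hc1⟩, ⟨hm2, hS2, hc2⟩⟩
    refine ⟨⟨?_, ?_, ?_⟩, ?_⟩
    · intro s t hst
      induction s using Fin.addCases with
      | left s =>
        induction t using Fin.addCases with
        | left t => exact hm1 (show s.val ≤ t.val from hst)
        | right t => exact (h _ (hS1 s) _ (hS2 t)).le
      | right s =>
        induction t using Fin.addCases with
        | left t =>
          have : c + s.val ≤ t.val := hst
          omega
        | right t => exact hm2 (by simpa using hst)
    · intro t
      induction t using Fin.addCases with
      | left t => exact mem_union_left _ (hS1 t)
      | right t => exact mem_union_right _ (hS2 t)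
    · intro q
      rw [card_filter_append p (· = q)]
      by_cases hq : q ∈ S₁
      · have : #{t | p (Fin.natAdd c t) = q} = 0 := by
          rw [card_eq_zero, filter_eq_empty_iff]
          rintro t - rfl
          exact hdisj _ hq (hS2 t)
        rw [this]
        exact hc1 q
      · have : #{t | p (Fin.castAdd e t) = q} = 0 := by
          rw [card_eq_zero, filter_eq_empty_iff]
          rintro t - rfl
          exact hq (hS1 t)
        rw [this, zero_add]
        exact hc2 q
    · rw [card_filter_append p (· ∈ S₁), filter_true_of_mem fun t _ => hS1 t,
        filter_false_of_mem fun t _ h1 => hdisj _ h1 (hS2 t)]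
      simp

/-- Splitting a sequence at the point where it passes from `S₁` to `S₂`. -/
theorem tau_union {S₁ S₂ : Finset (Fin m)} (h : ∀ p ∈ S₁, ∀ q ∈ S₂, p < q) :
    tau x (S₁ ∪ S₂) = conv (tau x S₁) (tau x S₂) := by
  classical
  funext d r
  rw [conv, tau_eq]
  rw [← sum_fiberwise_of_maps_to (t := antidiagonal d)
    (g := fun p : Fin d → Fin m => (#{t | p t ∈ S₁}, d - #{t | p t ∈ S₁}))]
  swap
  · intro p _
    have : #{t | p t ∈ S₁} ≤ d := (card_le_univ _).trans (by simp)
    simp only [HasAntidiagonal.mem_antidiagonal]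
    omega
  refine sum_congr rfl ?_
  rintro ⟨c, e⟩ hce
  obtain rfl : c + e = d := by simpa using hce
  simp only [tau_eq]
  rw [sum_mul_sum, ← sum_product']
  have hiff : ∀ p : Fin (c + e) → Fin m,
      (#{t | p t ∈ S₁}, c + e - #{t | p t ∈ S₁}) = (c, e) ↔ #{t | p t ∈ S₁} = c := by
    intro p
    simp only [Prod.mk.injEq]
    omega
  refine sum_nbij' (fun p => (fun t => p (Fin.castAdd e t), fun t => p (Fin.natAdd c t)))
    (fun p => Fin.append p.1 p.2) ?_ ?_ ?_ ?_ ?_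
  · intro p hp
    simp only [mem_filter, mem_univ, true_and, mem_product, hiff] at hp ⊢
    exact (admissible_append_iff h p).1 hp
  · rintro ⟨p, q⟩ hp
    simp only [mem_filter, mem_univ, true_and, mem_product, hiff] at hp ⊢
    exact (admissible_append_iff h _).2 (by simpa using hp)
  · intro p _
    exact Fin.append_castAdd_natAdd
  · rintro ⟨p, q⟩ _
    simp
  · intro p _
    simp only [Fin.prod_univ_add, Fin.val_castAdd, Fin.val_natAdd, Nat.cast_add, sub_sub]

theorem tau_zero (S : Finset (Fin m)) (r : ZMod n) : tau x S 0 r = 1 := by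
  classical
  rw [tau_eq, filter_true_of_mem]
  · simp
  · intro p _
    exact ⟨fun s => s.elim0, fun s => s.elim0, fun q => by simp⟩

/-- A sequence longer than `(n - 1) |S|` must repeat some index too often. -/
theorem tau_eq_zero {S : Finset (Fin m)} {k : ℕ} (h : (n - 1) * #S < k) (r : ZMod n) :
    tau x S k r = 0 := by
  classical
  rw [tau_eq, filter_false_of_mem, sum_empty]
  rintro p - ⟨-, hS, hc⟩
  have h1 := card_eq_sum_card_fiberwise (s := univ) (t := S) (f := p) fun t _ => hS t
  have h2 : ∑ q ∈ S, #{t | p t = q} ≤ ∑ _q ∈ S, (n - 1) := sum_le_sum fun q _ => hc q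
  rw [sum_const, smul_eq_mul, mul_comm] at h2
  rw [card_univ, Fintype.card_fin] at h1
  omega

theorem tau_singleton (q : Fin m) {k : ℕ} (hk : k ≤ n - 1) (r : ZMod n) :
    tau x {q} k r = descProd (x q) k r := by
  classical
  rw [tau_eq, descProd, ← Fin.prod_univ_eq_prod_range (fun t => x q (r - (t : ZMod n))) k]
  rw [sum_eq_single_of_mem (fun _ => q)]
  · simp only [mem_filter, mem_univ, true_and]
    refine ⟨monotone_const, by simp, fun q' => (card_le_univ _).trans (by simpa using hk)⟩
  · intro p hp hne
    simp only [mem_filter, mem_univ, true_and] at hp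
    exact absurd (funext fun t => mem_singleton.1 (hp.mem t)) hne

variable {x}

theorem tau_nonneg (hx : ∀ p r, 0 < x p r) (S : Finset (Fin m)) (k : ℕ) (r : ZMod n) :
    0 ≤ tau x S k r :=
  sum_nonneg fun _ _ => prod_nonneg fun _ _ => (hx _ _).le

theorem sigma_pos (hx : ∀ p r, 0 < x p r) (i k : Fin m) (d : ℕ) (r : ZMod n) :
    0 < sigma x i k d r := by
  refine sum_pos' (fun a _ => mul_nonneg (prod_nonneg fun _ _ => (hx _ _).le)
    (tau_nonneg hx _ _ _)) ⟨d, by simp, ?_⟩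
  rw [Nat.sub_self, tau_zero, mul_one]
  exact prod_pos fun _ _ => hx _ _

theorem sigmaBar_pos (hx : ∀ p r, 0 < x p r) (k j : Fin m) (d : ℕ) (r : ZMod n) :
    0 < sigmaBar x k j d r := by
  refine sum_pos' (fun a _ => mul_nonneg (tau_nonneg hx _ _ _)
    (prod_nonneg fun _ _ => (hx _ _).le)) ⟨d, by simp, ?_⟩
  rw [Nat.sub_self, tau_zero, one_mul]
  exact prod_pos fun _ _ => hx _ _

theorem Omega_pos (hn : 0 < n) (hx : ∀ p r, 0 < x p r) (i k j : Fin m) (r : ZMod n) :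
    0 < Omega x i k j r :=
  sum_pos (fun _ _ => mul_pos (sigma_pos hx _ _ _ _) (sigmaBar_pos hx _ _ _ _))
    ⟨0, by simpa using hn⟩

variable (x)

/-- In degrees at least `(n-1)(k-i)` the truncated factors of `sigma` are exhausted, and the extra
degree is carried by the untruncated vector `x_i`. -/
theorem sigma_add (i k : Fin m) (l : ℕ) (r : ZMod n) :
    sigma x i k ((n - 1) * (k.val - i.val) + l) r =
      descProd (x i) l r * sigma x i k ((n - 1) * (k.val - i.val)) (r - (l : ZMod n)) := by
  set D := (n - 1) * (k.val - i.val) with hD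
  -- The first `l` terms vanish: in them `tau` has degree above `D`.
  rw [sigma_eq_conv, conv_eq_sum_range, conv_eq_sum_range, add_comm D l, add_assoc,
    sum_range_add, mul_sum, sum_eq_zero, zero_add]
  · refine sum_congr rfl fun a _ => ?_
    rw [descProd_add, Nat.add_sub_add_left, Nat.cast_add, sub_sub, mul_assoc]
  · intro a ha
    rw [tau_eq_zero, mul_zero]
    rw [Fin.card_Ioc]
    have := mem_range.1 ha
    omega

/-- The analogue of `sigma_add`: the truncated factors of `sigmaBar` are those of
`x_{k+1}, …, x_{j-1}`, so their top degree is `(n-1)(j-k-1)`. -/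
theorem sigmaBar_add (k j : Fin m) (l : ℕ) (r : ZMod n) :
    sigmaBar x k j ((n - 1) * (j.val - k.val - 1) + l) r =
      sigmaBar x k j ((n - 1) * (j.val - k.val - 1)) r *
        descProd (x j) l (r - (((n - 1) * (j.val - k.val - 1) : ℕ) : ZMod n)) := by
  set D := (n - 1) * (j.val - k.val - 1) with hD
  rw [sigmaBar_eq_conv, conv_eq_sum_range_snd, conv_eq_sum_range_snd, add_comm D l, add_assoc,
    sum_range_add, sum_mul, sum_eq_zero, zero_add]
  · refine sum_congr rfl fun a ha => ?_
    have ha : a ≤ D := by simpa [Nat.lt_succ_iff] using ha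
    rw [Nat.add_sub_add_left, add_comm l a, descProd_add, sub_sub, ← Nat.cast_add,
      Nat.sub_add_cancel ha, mul_assoc]
  · intro a ha
    rw [tau_eq_zero, zero_mul]
    rw [Fin.card_Ioo]
    have := mem_range.1 ha
    omega

/-- Convolution on the right with the truncated factor of a single vector. -/
theorem conv_tau_singleton (hn : 0 < n) (f : ℕ → ZMod n → ℝ) (q : Fin m) (D : ℕ) (r : ZMod n) :
    conv f (tau x {q}) (D + (n - 1)) r =
      ∑ l ∈ range n, f (D + l) r *
        descProd (x q) (n - 1 - l) (r - ((D + l : ℕ) : ZMod n)) := by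
  -- The first `D` terms have more than `n - 1` factors `x_q` and vanish.
  rw [conv_eq_sum_range, show D + (n - 1) + 1 = D + n by omega, sum_range_add, sum_eq_zero,
    zero_add]
  · refine sum_congr rfl fun l _ => ?_
    rw [tau_singleton _ _ (by omega), Nat.add_sub_add_left]
  · intro a ha
    rw [tau_eq_zero, mul_zero]
    have := mem_range.1 ha
    rw [card_singleton]
    omega

/-- Convolution on the left with the truncated factor of a single vector. -/
theorem tau_singleton_conv (hn : 0 < n) (f : ℕ → ZMod n → ℝ) (q : Fin m) (D : ℕ) (r : ZMod n) :
    conv (tau x {q}) f (D + (n - 1)) r =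
      ∑ l ∈ range n, descProd (x q) l r * f (D + (n - 1) - l) (r - (l : ZMod n)) := by
  -- The last `D` terms have more than `n - 1` factors `x_q` and vanish.
  rw [conv_eq_sum_range, show D + (n - 1) + 1 = n + D by omega, sum_range_add]
  rw [sum_eq_zero (s := range D), add_zero]
  · refine sum_congr rfl fun l hl => ?_
    have := mem_range.1 hl
    rw [tau_singleton _ _ (by omega)]
  · intro a ha
    rw [tau_eq_zero, zero_mul]
    rw [card_singleton]
    omega

theorem sigma_succ (hn : 0 < n) {i p q : Fin m} (hip : i ≤ p) (hq : q.val = p.val + 1)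
    (r : ZMod n) :
    sigma x i q ((n - 1) * (q.val - i.val)) r =
      ∑ l ∈ range n, sigma x i p ((n - 1) * (p.val - i.val) + l) r *
        descProd (x q) (n - 1 - l)
          (r - (((n - 1) * (p.val - i.val) + l : ℕ) : ZMod n)) := by
  have hip' : i.val ≤ p.val := hip
  have hS : Ioc i q = Ioc i p ∪ {q} := by
    ext t
    simp only [mem_Ioc, mem_union, mem_singleton, Fin.lt_def, Fin.le_def, Fin.ext_iff]
    omega
  have hD : (n - 1) * (q.val - i.val) = (n - 1) * (p.val - i.val) + (n - 1) := by
    rw [hq, Nat.sub_add_comm hip', Nat.mul_succ]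
  rw [sigma_eq_conv, hS, tau_union, ← conv_assoc, ← sigma_eq_conv, hD, conv_tau_singleton x hn]
  intro s hs t ht
  simp only [mem_Ioc, mem_singleton, Fin.lt_def, Fin.le_def] at *
  subst ht
  omega

theorem sigmaBar_pred (hn : 0 < n) {k q j : Fin m} (hq : q.val = k.val + 1) (hqj : q < j)
    (r : ZMod n) :
    sigmaBar x k j ((n - 1) * (j.val - k.val - 1)) r =
      ∑ l ∈ range n, descProd (x q) l r *
        sigmaBar x q j ((n - 1) * (j.val - q.val - 1) + (n - 1) - l) (r - (l : ZMod n)) := by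
  have hqj' : q.val < j.val := hqj
  have hS : Ioo k j = {q} ∪ Ioo q j := by
    ext t
    simp only [mem_Ioo, mem_union, mem_singleton, Fin.lt_def, Fin.ext_iff]
    omega
  have hD : (n - 1) * (j.val - k.val - 1) = (n - 1) * (j.val - q.val - 1) + (n - 1) := by
    rw [← Nat.mul_succ]
    congr 1
    omega
  rw [sigmaBar_eq_conv, hS, tau_union, conv_assoc, ← sigmaBar_eq_conv, hD,
    tau_singleton_conv x hn]
  intro s hs t ht
  simp only [mem_Ioo, mem_singleton, Fin.lt_def] at *
  subst hs
  omega

end Tau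

/-! ### The birational R-matrix -/

section RMatrix

variable {n : ℕ}

/-- `κ_r` as a convolution: read downwards from the index `r - 1`, the entries of `a` come before
those of `b`. -/
theorem kappa_eq (a b : ZMod n → ℝ) (r : ZMod n) :
    kappa a b r = ∑ l ∈ range n,
      descProd a l (r - 1) * descProd b (n - 1 - l) (r - (l : ZMod n) - 1) := by
  rw [kappa, ← sum_range_reflect]
  refine sum_congr rfl fun l hl => ?_
  have hl := mem_range.1 hl
  rw [mul_comm]
  congr 1
  · rw [descProd]
    refine prod_nbij' (fun t => n - 1 - t) (fun t => n - 1 - t) ?_ ?_ ?_ ?_ ?_ <;>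
      simp only [mem_Icc, mem_range] <;> intro t ht
    · omega
    · omega
    · omega
    · omega
    · congr 1
      rw [Nat.cast_sub (by omega), Nat.cast_sub (by omega)]
      simp
      ring
  · rw [descProd]
    refine prod_nbij' (fun t => n - 1 - l - t) (fun t => n - 1 - l - t) ?_ ?_ ?_ ?_ ?_ <;>
      simp only [mem_Icc, mem_range] <;> intro t ht
    · omega
    · omega
    · omega
    · omega
    · congr 1
      rw [Nat.cast_sub (by omega), Nat.cast_sub (by omega), Nat.cast_sub (by omega)]
      simp
      ring

variable {a b c : ZMod n → ℝ}

/-- Equality of the loop elementary symmetric functions of two triples of vectors: with `T` the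
operator lowering the upper index, `(1 - cT)(1 - bT)(1 - aT) = (1 - c'T)(1 - b'T)(1 - a'T)`. -/
structure LoopEq (a b c a' b' c' : ZMod n → ℝ) : Prop where
  e₁ : ∀ r, a r + b r + c r = a' r + b' r + c' r
  e₂ : ∀ r, c r * b (r - 1) + c r * a (r - 1) + b r * a (r - 1) =
    c' r * b' (r - 1) + c' r * a' (r - 1) + b' r * a' (r - 1)
  e₃ : ∀ r, c r * b (r - 1) * a (r - 2) = c' r * b' (r - 1) * a' (r - 2)

theorem LoopEq.trans {a' b' c' a'' b'' c'' : ZMod n → ℝ} (h : LoopEq a b c a' b' c')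
    (h' : LoopEq a' b' c' a'' b'' c'') : LoopEq a b c a'' b'' c'' :=
  ⟨fun r => (h.e₁ r).trans (h'.e₁ r), fun r => (h.e₂ r).trans (h'.e₂ r),
    fun r => (h.e₃ r).trans (h'.e₃ r)⟩

theorem LoopEq.symm {a' b' c' : ZMod n → ℝ} (h : LoopEq a b c a' b' c') :
    LoopEq a' b' c' a b c :=
  ⟨fun r => (h.e₁ r).symm, fun r => (h.e₂ r).symm, fun r => (h.e₃ r).symm⟩

variable [NeZero n]

/-- Induction around the cycle `ZMod n`, from any starting point. -/
theorem cyclic_induction {P : ZMod n → Prop} (h : ∀ r, P r → P (r + 1)) {r₀ : ZMod n}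
    (h₀ : P r₀) (r : ZMod n) : P r := by
  have key : ∀ k : ℕ, P (r₀ + k) := by
    intro k
    induction k with
    | zero => simpa using h₀
    | succ k ih => simpa [add_assoc] using h _ ih
  simpa using key (r - r₀).val

theorem descProd_period_const {a : ZMod n → ℝ} (ha : ∀ r, 0 < a r) (r s : ZMod n) :
    descProd a n r = descProd a n s :=
  cyclic_induction (P := fun r => descProd a n r = descProd a n s)
    (fun r h => (descProd_period ha r).trans h) rfl r

theorem kappa_pos {a b : ZMod n → ℝ} (ha : ∀ r, 0 < a r) (hb : ∀ r, 0 < b r) (r : ZMod n) :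
    0 < kappa a b r :=
  sum_pos (fun _ _ => mul_pos (prod_pos fun _ _ => hb _) (prod_pos fun _ _ => ha _))
    ⟨0, by simpa using NeZero.pos n⟩

/-- The sums `a_r κ_r` and `b_{r+1} κ_{r+1}` share all terms but the extreme ones. -/
theorem mul_kappa_sub (a b : ZMod n → ℝ) (r : ZMod n) :
    a r * kappa a b r - b (r + 1) * kappa a b (r + 1) = descProd a n r - descProd b n r := by
  set T : ℕ → ℝ := fun l => descProd a l r * descProd b (n - l) (r - (l : ZMod n)) with hT
  have hn := NeZero.pos n
  have h1 : a r * kappa a b r = ∑ l ∈ range n, T (l + 1) := by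
    rw [kappa_eq, mul_sum]
    refine sum_congr rfl fun l _ => ?_
    simp only [hT]
    rw [add_comm l 1, descProd_add, descProd_one, Nat.sub_sub, ← mul_assoc]
    push_cast
    ring_nf
  have h2 : b (r + 1) * kappa a b (r + 1) = ∑ l ∈ range n, T l := by
    rw [kappa_eq, mul_sum]
    refine sum_congr rfl fun l hl => ?_
    have hl := mem_range.1 hl
    simp only [hT]
    have e1 : n - l = (n - 1 - l) + 1 := by omega
    have e2 : r - (l : ZMod n) - ((n - 1 - l : ℕ) : ZMod n) = r + 1 := by
      rw [Nat.cast_sub (by omega), Nat.cast_sub (by omega)]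
      simp
    have e3 : r + 1 - (l : ZMod n) - 1 = r - l := by ring
    rw [e1, descProd_add, descProd_one, e2, add_sub_cancel_right, e3]
    ring
  rw [h1, h2, ← sum_sub_distrib, sum_range_sub]
  simp [hT, descProd_zero]

theorem eta_fst_pos (ha : ∀ r, 0 < a r) (hb : ∀ r, 0 < b r) (r : ZMod n) :
    0 < (eta a b).1 r :=
  div_pos (mul_pos (hb _) (kappa_pos ha hb _)) (kappa_pos ha hb _)

theorem eta_snd_pos (ha : ∀ r, 0 < a r) (hb : ∀ r, 0 < b r) (r : ZMod n) :
    0 < (eta a b).2 r :=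
  div_pos (mul_pos (ha _) (kappa_pos ha hb _)) (kappa_pos ha hb _)

theorem eta_mul (ha : ∀ r, 0 < a r) (hb : ∀ r, 0 < b r) (r : ZMod n) :
    (eta a b).1 (r - 1) * (eta a b).2 r = a (r - 1) * b r := by
  have h1 := (kappa_pos ha hb r).ne'
  have h2 := (kappa_pos ha hb (r - 1)).ne'
  simp only [eta, sub_add_cancel]
  field_simp

theorem eta_add (ha : ∀ r, 0 < a r) (hb : ∀ r, 0 < b r) (r : ZMod n) :
    (eta a b).1 r + (eta a b).2 r = a r + b r := by
  have h1 := mul_kappa_sub a b r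
  have h2 := mul_kappa_sub a b (r - 1)
  rw [descProd_period_const ha (r - 1) r, descProd_period_const hb (r - 1) r,
    sub_add_cancel] at h2
  simp only [eta]
  rw [← add_div, div_eq_iff (kappa_pos ha hb r).ne']
  linear_combination h2 - h1

theorem descProd_eta_fst (ha : ∀ r, 0 < a r) (hb : ∀ r, 0 < b r) (r s : ZMod n) :
    descProd (eta a b).1 n r = descProd b n s := by
  have e : (eta a b).1 =
      fun s => b (s + 1) * (fun s => kappa a b (s + 1) / kappa a b (s - 1 + 1)) s := by
    funext s
    simp only [eta, sub_add_cancel, mul_div_assoc]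
  rw [e, descProd_mul, descProd_shift,
    descProd_ratio (f := fun s => kappa a b (s + 1)) (fun s => kappa_pos ha hb _)]
  rw [CharP.cast_eq_zero, sub_zero, div_self (kappa_pos ha hb _).ne', mul_one]
  exact descProd_period_const hb _ _

/-- A function on the cycle that is positive everywhere, negative everywhere or zero
everywhere. -/
def OneSigned (G : ZMod n → ℝ) : Prop :=
  (∀ r, 0 < G r) ∨ (∀ r, G r < 0) ∨ ∀ r, G r = 0

theorem oneSigned_of_pos {G H p q : ZMod n → ℝ} (hp : ∀ r, 0 < p r) (hq : ∀ r, 0 < q r)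
    (h : ∀ r, p r * G (r + 1) = q r * G r + H r) (hH : ∀ r, 0 < H r) : OneSigned G := by
  by_cases hG : ∃ r, 0 ≤ G r
  · obtain ⟨r₀, h₀⟩ := hG
    have step : ∀ r, 0 ≤ G r → 0 < G (r + 1) := by
      intro r hr
      have : 0 < p r * G (r + 1) := by
        rw [h]
        exact add_pos_of_nonneg_of_pos (mul_nonneg (hq r).le hr) (hH r)
      exact pos_of_mul_pos_right this (hp r).le
    exact Or.inl fun r => cyclic_induction (P := fun r => 0 < G r)
      (fun r hr => step r hr.le) (step r₀ h₀) r
  · push Not at hG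
    exact Or.inr (Or.inl hG)

/-- One-signedness of the inhomogeneous term passes to the solution of a first-order periodic
recurrence with positive coefficients. -/
theorem OneSigned.of_recurrence {G H p q : ZMod n → ℝ} (hH : OneSigned H)
    (hp : ∀ r, 0 < p r) (hq : ∀ r, 0 < q r)
    (h : ∀ r, p r * G (r + 1) = q r * G r + H r) : OneSigned G := by
  rcases hH with hH | hH | hH
  · exact oneSigned_of_pos hp hq h hH
  · have := oneSigned_of_pos (G := fun r => -G r) (H := fun r => -H r) hp hq
      (fun r => by linear_combination -h r) (fun r => neg_pos.2 (hH r))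
    rcases this with h1 | h1 | h1
    · exact Or.inr (Or.inl fun r => neg_pos.1 (h1 r))
    · exact Or.inl fun r => neg_lt_zero.1 (h1 r)
    · exact Or.inr (Or.inr fun r => neg_eq_zero.1 (h1 r))
  · have h' : ∀ r, p r * G (r + 1) = q r * G r := fun r => by rw [h, hH, add_zero]
    rcases lt_trichotomy (G 0) 0 with h0 | h0 | h0
    · refine Or.inr (Or.inl fun r => cyclic_induction (P := fun r => G r < 0) (fun r hr => ?_) h0 r)
      have : p r * G (r + 1) < 0 := by
        rw [h']
        exact mul_neg_of_pos_of_neg (hq r) hr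
      exact neg_of_mul_neg_right this (hp r).le
    · refine Or.inr (Or.inr fun r => cyclic_induction (P := fun r => G r = 0) (fun r hr => ?_) h0 r)
      have := h' r
      rw [hr, mul_zero] at this
      exact (mul_eq_zero.1 this).resolve_left (hp r).ne'
    · refine Or.inl fun r => cyclic_induction (P := fun r => 0 < G r) (fun r hr => ?_) h0 r
      have : 0 < p r * G (r + 1) := by
        rw [h']
        exact mul_pos (hq r) hr
      exact pos_of_mul_pos_right this (hp r).le

theorem loopEq_eta_left (ha : ∀ r, 0 < a r) (hb : ∀ r, 0 < b r) (c : ZMod n → ℝ) :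
    LoopEq a b c (eta a b).1 (eta a b).2 c where
  e₁ r := by linear_combination -eta_add ha hb r
  e₂ r := by linear_combination -c r * eta_add ha hb (r - 1) - eta_mul ha hb r
  e₃ r := by
    have := eta_mul ha hb (r - 1)
    rw [sub_sub, one_add_one_eq_two] at this
    linear_combination -c r * this

theorem loopEq_eta_right (hb : ∀ r, 0 < b r) (hc : ∀ r, 0 < c r) (a : ZMod n → ℝ) :
    LoopEq a b c a (eta b c).1 (eta b c).2 where
  e₁ r := by linear_combination -eta_add hb hc r
  e₂ r := by linear_combination -a (r - 1) * eta_add hb hc r - eta_mul hb hc r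
  e₃ r := by linear_combination -a (r - 2) * eta_mul hb hc r

/-- Uniqueness of the rightmost factor, given the product of its entries around the cycle. A
positive solution `f` of `f_r = a_r f_{r-1}` is annihilated by `(1 - c'T)(1 - b'T)(1 - a'T)`;
peeling off the factors from the left shows that `a - a'` is one-signed. -/
theorem LoopEq.fst_eq {a' b' c' : ZMod n → ℝ} (h : LoopEq a b c a' b' c')
    (ha : ∀ r, 0 < a r) (ha' : ∀ r, 0 < a' r) (hb' : ∀ r, 0 < b' r) (hc' : ∀ r, 0 < c' r)
    (hprod : descProd a n 0 = descProd a' n 0) : a = a' := by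
  -- `(1 - a'T) f` has the values `G_r f_{r-1}`, and `(1 - b'T)(1 - a'T) f` the values `H_r f_{r-2}`.
  set G : ZMod n → ℝ := fun r => a r - a' r with hG
  set H : ZMod n → ℝ := fun r => a (r - 1) * G r - b' r * G (r - 1) with hH
  have hHrec : ∀ r, a (r - 2) * H r = c' r * H (r - 1) := by
    intro r
    have e1 := h.e₁ r
    have e2 := h.e₂ r
    have e3 := h.e₃ r
    have e : r - 1 - 1 = r - 2 := by ring
    simp only [hH, hG, e]
    linear_combination a (r - 1) * a (r - 2) * e1 - a (r - 2) * e2 + e3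
  have hH1 : OneSigned H := by
    refine OneSigned.of_recurrence (H := fun _ => 0) (Or.inr (Or.inr fun _ => rfl))
      (p := fun r => a (r - 1)) (q := fun r => c' (r + 1)) (fun r => ha _) (fun r => hc' _) ?_
    intro r
    have := hHrec (r + 1)
    rw [add_sub_cancel_right, show r + 1 - 2 = r - 1 by ring] at this
    rw [this, add_zero]
  have hG1 : OneSigned G := by
    have hH2 : OneSigned fun r => H (r + 1) :=
      hH1.imp (fun h r => h _) (Or.imp (fun h r => h _) fun h r => h _)
    refine hH2.of_recurrence (p := a) (q := fun r => b' (r + 1)) ha (fun r => hb' _) ?_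
    intro r
    simp only [hH, add_sub_cancel_right]
    ring
  have hn := NeZero.pos n
  rcases hG1 with h1 | h1 | h1
  · refine absurd hprod (ne_of_gt ?_)
    exact prod_lt_prod (fun _ _ => ha' _) (fun _ _ => (sub_pos.1 (h1 _)).le)
      ⟨0, by simpa using hn, sub_pos.1 (h1 _)⟩
  · refine absurd hprod (ne_of_lt ?_)
    exact prod_lt_prod (fun _ _ => ha _) (fun _ _ => (sub_neg.1 (h1 _)).le)
      ⟨0, by simpa using hn, sub_neg.1 (h1 _)⟩
  · exact funext fun r => sub_eq_zero.1 (h1 r)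

/-- The first component of the Yang–Baxter equation for `η`: moving `c` to the front of
`(a, b, c)` gives the same vector whether or not `a` and `b` are exchanged beforehand. -/
theorem eta_yangBaxter_fst (ha : ∀ r, 0 < a r) (hb : ∀ r, 0 < b r) (hc : ∀ r, 0 < c r) :
    (eta (eta a b).1 (eta (eta a b).2 c).1).1 = (eta a (eta b c).1).1 := by
  have p1 := eta_fst_pos ha hb
  have p2 := eta_snd_pos ha hb
  have q1 := eta_fst_pos p2 hc
  have p1' := eta_fst_pos hb hc
  have p2' := eta_snd_pos hb hc
  have q2' := eta_snd_pos ha p1'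
  have h1 := ((loopEq_eta_left ha hb c).trans (loopEq_eta_right p2 hc _)).trans
    (loopEq_eta_left p1 q1 _)
  have h2 := ((loopEq_eta_right hb hc a).trans (loopEq_eta_left ha p1' _)).trans
    (loopEq_eta_right q2' p2' _)
  refine (h1.symm.trans h2).fst_eq (eta_fst_pos p1 q1) (eta_fst_pos ha p1')
    (eta_fst_pos q2' p2') (eta_snd_pos q2' p2') ?_
  rw [descProd_eta_fst p1 q1 0 0, descProd_eta_fst p2 hc 0 0, descProd_eta_fst ha p1' 0 0,
    descProd_eta_fst hb hc 0 0]

end RMatrix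

/-! ### The action of the transposition word -/

section Word

variable {n m : ℕ}

/-- An `m`-tuple of vectors as a sequence, continued by the constant vector `1` so that it stays
positive. -/
def extend (x : Fin m → ZMod n → ℝ) (p : ℕ) : ZMod n → ℝ :=
  if h : p < m then x ⟨p, h⟩ else 1

theorem extend_val (x : Fin m → ZMod n → ℝ) (p : Fin m) : extend x p.val = x p := by
  simp [extend]

theorem extend_eq (x : Fin m → ZMod n → ℝ) {p : ℕ} {q : Fin m} (h : p = q.val) :
    extend x p = x q := by
  rw [h, extend_val]

theorem extend_pos {x : Fin m → ZMod n → ℝ} (hx : ∀ p r, 0 < x p r) (p : ℕ) (r : ZMod n) :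
    0 < extend x p r := by
  unfold extend
  split
  · exact hx _ _
  · exact one_pos

theorem extend_simpleAct (x : Fin m → ZMod n → ℝ) {i : ℕ} (hi : i + 1 < m) (p : ℕ) :
    extend (simpleAct i x) p =
      if p = i then (eta (extend x i) (extend x (i + 1))).1
      else if p = i + 1 then (eta (extend x i) (extend x (i + 1))).2
      else extend x p := by
  have h1 : i < m := by omega
  by_cases hp : p < m
  · simp only [extend, simpleAct, hp, hi, h1, dif_pos]
  · simp only [extend, hp, dif_neg, not_false_eq_true]
    rw [if_neg (by omega), if_neg (by omega)]

theorem simpleAct_pos {x : Fin m → ZMod n → ℝ} [NeZero n] (hx : ∀ p r, 0 < x p r) (i : ℕ)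
    (p : Fin m) (r : ZMod n) : 0 < simpleAct i x p r := by
  by_cases hi : i + 1 < m
  · rw [← extend_val (simpleAct i x), extend_simpleAct x hi]
    split
    · exact eta_fst_pos (extend_pos hx _) (extend_pos hx _) r
    · split
      · exact eta_snd_pos (extend_pos hx _) (extend_pos hx _) r
      · exact extend_pos hx _ r
  · rw [simpleAct, dif_neg hi]
    exact hx p r

/-- The vector obtained by moving `X_i` to the right past `X_{i+1}, …, X_{i+t}`. -/
def moveRight (X : ℕ → ZMod n → ℝ) (i : ℕ) : ℕ → ZMod n → ℝ
  | 0 => X i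
  | t + 1 => (eta (moveRight X i t) (X (i + t + 1))).2

/-- The vector obtained by moving `X_j` to the left past `X_{j-1}, …, X_{j-t}`, for `t ≤ j`. -/
def moveLeft (X : ℕ → ZMod n → ℝ) (j : ℕ) : ℕ → ZMod n → ℝ
  | 0 => X j
  | t + 1 => (eta (X (j - (t + 1))) (moveLeft X j t)).1

theorem moveLeft_congr {X Y : ℕ → ZMod n → ℝ} (j t : ℕ) (h : ∀ p, j - t ≤ p → X p = Y p) :
    moveLeft X j t = moveLeft Y j t := by
  induction t with
  | zero => exact h j (by omega)
  | succ t ih =>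
    rw [moveLeft, moveLeft, h _ le_rfl, ih fun p hp => h p (by omega)]

theorem moveLeft_pos [NeZero n] {X : ℕ → ZMod n → ℝ} (hX : ∀ p r, 0 < X p r) (j t : ℕ) :
    ∀ r, 0 < moveLeft X j t r := by
  induction t with
  | zero => exact hX j
  | succ t ih => exact eta_fst_pos (hX _) ih

theorem moveRight_pos [NeZero n] {X : ℕ → ZMod n → ℝ} (hX : ∀ p r, 0 < X p r) (i t : ℕ) :
    ∀ r, 0 < moveRight X i t r := by
  induction t with
  | zero => exact hX i
  | succ t ih => exact eta_snd_pos ih (hX _)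

theorem transWord_one (i : ℕ) : transWord i (i + 1) = [i] := by
  simp [transWord]

theorem transWord_succ (i d : ℕ) :
    transWord i (i + d + 2) = i :: (transWord (i + 1) (i + d + 2) ++ [i]) := by
  have h1 : i + d + 2 - 1 - i = d + 1 := by omega
  have h2 : i + d + 2 - 1 - (i + 1) = d := by omega
  simp only [transWord, h1, h2, List.range'_succ]
  simp

theorem wordPerm_transWord {d : ℕ} : ∀ {i : ℕ} (h : i + d + 1 < m),
    wordPerm (transWord i (i + d + 1)) =
      Equiv.swap (⟨i, by omega⟩ : Fin m) ⟨i + d + 1, h⟩ := by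
  induction d with
  | zero =>
    intro i h
    simp only [add_zero] at h ⊢
    rw [transWord_one]
    simp [wordPerm, simplePerm, h]
  | succ d ih =>
    intro i h
    have hs : simplePerm i = Equiv.swap (⟨i + 1, by omega⟩ : Fin m) ⟨i, by omega⟩ := by
      rw [simplePerm, dif_pos (by omega), Equiv.swap_comm]
    have ih' : wordPerm (transWord (i + 1) (i + d + 2)) =
        Equiv.swap (⟨i + d + 2, h⟩ : Fin m) ⟨i + 1, by omega⟩ := by
      have := @ih (i + 1) (by omega)
      rw [Equiv.swap_comm]
      simpa only [show i + 1 + d + 1 = i + d + 2 by omega] using this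
    have e : wordPerm (transWord i (i + d + 2)) =
        simplePerm i * wordPerm (transWord (i + 1) (i + d + 2)) *
          (simplePerm i : Equiv.Perm (Fin m)) := by
      rw [transWord_succ]
      simp [wordPerm, mul_assoc]
    have : wordPerm (transWord i (i + (d + 1) + 1)) = _ := e
    rw [this, hs, ih', Equiv.swap_mul_swap_mul_swap]
    · rfl
    · simp only [ne_eq, Fin.ext_iff]
      omega
    · simp only [ne_eq, Fin.ext_iff]
      omega

theorem moveRight_simpleAct (x : Fin m → ZMod n → ℝ) {i : ℕ} (hi : i + 1 < m) (t : ℕ) :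
    moveRight (extend (simpleAct i x)) (i + 1) t = moveRight (extend x) i (t + 1) := by
  induction t with
  | zero =>
    simp only [moveRight]
    rw [extend_simpleAct x hi, if_neg (by omega), if_pos rfl]
  | succ t ih =>
    rw [moveRight, ih, extend_simpleAct x hi, if_neg (by omega), if_neg (by omega)]
    conv_rhs => rw [moveRight]
    rw [show i + 1 + t + 1 = i + (t + 1) + 1 by omega]

/-- The action of `s_i ⋯ s_{j-1} ⋯ s_i`, where `j = i + d + 1`, in terms of `x_i` moved right and
`x_j` moved left, each through the original vectors. -/
theorem extend_wordAct_transWord [NeZero n] {d : ℕ} :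
    ∀ {i : ℕ} (x : Fin m → ZMod n → ℝ) (_ : ∀ p r, 0 < x p r) (_ : i + d + 1 < m),
      extend (wordAct (transWord i (i + d + 1)) x) i =
        (eta (extend x i) (moveLeft (extend x) (i + d + 1) d)).1 ∧
      (∀ s < d, extend (wordAct (transWord i (i + d + 1)) x) (i + s + 1) =
        (eta (eta (moveRight (extend x) i s) (extend x (i + s + 1))).1
          (eta (moveRight (extend x) i (s + 1))
            (moveLeft (extend x) (i + d + 1) (d - s - 1))).1).2) ∧
      ∀ p < i, extend (wordAct (transWord i (i + d + 1)) x) p = extend x p := by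
  induction d with
  | zero =>
    intro i x hx h
    refine ⟨?_, fun s hs => absurd hs (by omega), fun p hp => ?_⟩ <;>
      simp only [add_zero] at h ⊢ <;>
      rw [transWord_one] <;>
      simp only [wordAct, List.foldr, moveLeft] <;>
      rw [extend_simpleAct x h]
    · rw [if_pos rfl]
    · rw [if_neg (by omega), if_neg (by omega)]
  | succ d ih =>
    intro i x hx h
    have hi : i + 1 < m := by omega
    set z := simpleAct i x with hz
    set y := wordAct (transWord (i + 1) (i + d + 2)) z with hy
    have hword : wordAct (transWord i (i + (d + 1) + 1)) x = simpleAct i y := by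
      have : transWord i (i + (d + 1) + 1) = _ := transWord_succ i d
      rw [this]
      simp [wordAct, hy, hz]
    have hX := extend_pos hx
    obtain ⟨ih1, ih2, ih3⟩ := @ih (i + 1) z (simpleAct_pos hx i) (by omega)
    have ej : i + 1 + d + 1 = i + d + 2 := by omega
    rw [ej] at ih1 ih2 ih3
    rw [← hy] at ih1 ih2 ih3
    have hzi : extend z i = (eta (extend x i) (extend x (i + 1))).1 := by
      rw [hz, extend_simpleAct x hi, if_pos rfl]
    have hzi' : extend z (i + 1) = (eta (extend x i) (extend x (i + 1))).2 := by
      rw [hz, extend_simpleAct x hi, if_neg (by omega), if_pos rfl]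
    have hzp : ∀ p, i + 1 < p → extend z p = extend x p := by
      intro p hp
      rw [hz, extend_simpleAct x hi, if_neg (by omega), if_neg (by omega)]
    have hleft : ∀ t ≤ d, moveLeft (extend z) (i + d + 2) t = moveLeft (extend x) (i + d + 2) t :=
      fun t ht => moveLeft_congr _ _ fun p hp => hzp p (by omega)
    rw [hleft d le_rfl, hzi'] at ih1
    have hyi : extend y i = extend z i := ih3 i (by omega)
    rw [hword, show i + (d + 1) + 1 = i + d + 2 by omega]
    refine ⟨?_, ?_, ?_⟩
    · rw [extend_simpleAct y hi, if_pos rfl, hyi, hzi, ih1,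
        eta_yangBaxter_fst (hX _) (hX _) (moveLeft_pos hX _ _), moveLeft,
        show i + d + 2 - (d + 1) = i + 1 by omega]
    · intro s hs
      rcases s with _ | s
      · rw [add_zero, extend_simpleAct y hi, if_neg (by omega), if_pos rfl, hyi, hzi, ih1]
        rfl
      · rw [extend_simpleAct y hi, if_neg (by omega), if_neg (by omega),
          show i + (s + 1) + 1 = i + 1 + s + 1 by omega, ih2 s (by omega),
          hleft _ (by omega), moveRight_simpleAct x hi, moveRight_simpleAct x hi,
          hzp _ (by omega), show d + 1 - (s + 1) - 1 = d - s - 1 by omega]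
    · intro p hp
      rw [extend_simpleAct y hi, if_neg (by omega), if_neg (by omega), ih3 p (by omega), hz,
        extend_simpleAct x hi, if_neg (by omega), if_neg (by omega)]

end Word

/-! ### The moved vectors and Omega -/

section Formulas

variable {n m : ℕ}

theorem sigma_zero (x : Fin m → ZMod n → ℝ) (i k : Fin m) (r : ZMod n) :
    sigma x i k 0 r = 1 := by
  simp [sigma, tau_zero]

theorem sigmaBar_zero (x : Fin m → ZMod n → ℝ) (k j : Fin m) (r : ZMod n) :
    sigmaBar x k j 0 r = 1 := by
  simp [sigmaBar, tau_zero]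

variable {x : Fin m → ZMod n → ℝ}

/-- The product of consecutive entries of the vector `x_i` moved right past `x_{i+1}, …, x_p`. -/
theorem descProd_of_right_formula (hx : ∀ p r, 0 < x p r) {i p : Fin m} {w : ZMod n → ℝ}
    {c : ZMod n}
    (hw : ∀ r, w r = x i (r - c) * (sigma x i p ((n - 1) * (p.val - i.val)) (r - c - 1) /
      sigma x i p ((n - 1) * (p.val - i.val)) (r - c))) (l : ℕ) (r : ZMod n) :
    descProd w l r = sigma x i p ((n - 1) * (p.val - i.val) + l) (r - c) /
      sigma x i p ((n - 1) * (p.val - i.val)) (r - c) := by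
  have hS := fun r => (sigma_pos hx i p ((n - 1) * (p.val - i.val)) r).ne'
  rw [sigma_add]
  induction l with
  | zero => simp [descProd_zero, hS]
  | succ l ih =>
    rw [descProd_add, ih, descProd_one, hw, descProd_add, descProd_one]
    have e1 : r - (l : ZMod n) - c = r - c - (l : ZMod n) := by ring
    have e2 : r - c - ((l + 1 : ℕ) : ZMod n) = r - c - (l : ZMod n) - 1 := by push_cast; ring
    rw [e1, e2]
    have := hS (r - c)
    have := hS (r - c - l)
    field_simp

variable [NeZero n]

theorem cast_pred_mul (t : ℕ) : (((n - 1) * t : ℕ) : ZMod n) = -(t : ZMod n) := by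
  rw [Nat.cast_mul, Nat.cast_sub (NeZero.pos n)]
  simp

/-- The product of consecutive entries of the vector `x_j` moved left past
`x_{j-1}, …, x_{k+1}`. -/
theorem descProd_of_left_formula (hx : ∀ p r, 0 < x p r) {k j : Fin m} {u : ZMod n → ℝ}
    (hu : ∀ r, u r = x j (r + ((j.val - k.val - 1 : ℕ) : ZMod n)) *
      (sigmaBar x k j ((n - 1) * (j.val - k.val - 1)) r /
        sigmaBar x k j ((n - 1) * (j.val - k.val - 1)) (r - 1))) (l : ℕ) (r : ZMod n) :
    descProd u l r = sigmaBar x k j ((n - 1) * (j.val - k.val - 1) + l) r /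
      sigmaBar x k j ((n - 1) * (j.val - k.val - 1)) (r - (l : ZMod n)) := by
  have hB := sigmaBar_pos hx k j ((n - 1) * (j.val - k.val - 1))
  rw [funext hu, descProd_mul, descProd_ratio hB, descProd_shift, sigmaBar_add, cast_pred_mul,
    sub_neg_eq_add]
  ring

/-- The vector `x_i` moved right past `x_{i+1}, …, x_p`, where `p = i + t`. Each step is controlled
by `sigma_succ`, which identifies `κ` with a ratio of values of `sigma`. -/
theorem moveRight_formula (hx : ∀ p r, 0 < x p r) (i : Fin m) (t : ℕ) :
    ∀ p : Fin m, p.val = i.val + t → ∀ r, moveRight (extend x) i.val t r =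
      x i (r - (t : ZMod n)) * (sigma x i p ((n - 1) * (p.val - i.val)) (r - (t : ZMod n) - 1) /
        sigma x i p ((n - 1) * (p.val - i.val)) (r - (t : ZMod n))) := by
  induction t with
  | zero =>
    intro p hp r
    have h0 : (n - 1) * (p.val - i.val) = 0 := by rw [hp]; simp
    simp [moveRight, extend_val, h0, sigma_zero]
  | succ t ih =>
    intro q hq r
    have hpm : i.val + t < m := by omega
    set p : Fin m := ⟨i.val + t, hpm⟩ with hp
    have hw := ih p rfl
    set w := moveRight (extend x) i.val t with hwdef
    have hpi : p.val - i.val = t := by simp [hp]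
    have hk : ∀ r, kappa w (x q) r =
        sigma x i q ((n - 1) * (q.val - i.val)) (r - 1 - (t : ZMod n)) /
          sigma x i p ((n - 1) * (p.val - i.val)) (r - 1 - (t : ZMod n)) := by
      intro r
      rw [kappa_eq, sigma_succ x (NeZero.pos n) (p := p) (by simp [hp, Fin.le_def]) hq, sum_div]
      refine sum_congr rfl fun l _ => ?_
      rw [descProd_of_right_formula hx hw, Nat.cast_add, cast_pred_mul, hpi]
      rw [show r - 1 - (t : ZMod n) - (-(t : ZMod n) + l) = r - l - 1 by ring]
      ring
    rw [moveRight, ← hwdef, extend_eq x (q := q) (by omega)]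
    simp only [eta]
    rw [hk, hk, hw]
    have e1 : r - ((t + 1 : ℕ) : ZMod n) = r - 1 - (t : ZMod n) := by push_cast; ring
    have e2 : r - 1 - 1 - (t : ZMod n) = r - 1 - (t : ZMod n) - 1 := by ring
    rw [e1, e2]
    have h1 := (sigma_pos hx i p ((n - 1) * (p.val - i.val)) (r - 1 - (t : ZMod n))).ne'
    have h2 := (sigma_pos hx i p ((n - 1) * (p.val - i.val)) (r - 1 - (t : ZMod n) - 1)).ne'
    have h3 := (sigma_pos hx i q ((n - 1) * (q.val - i.val)) (r - 1 - (t : ZMod n))).ne'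
    field_simp

/-- The vector `x_j` moved left past `x_{j-1}, …, x_{k+1}`, where `t = j - k - 1`. -/
theorem moveLeft_formula (hx : ∀ p r, 0 < x p r) (j : Fin m) (t : ℕ) :
    ∀ k : Fin m, k.val + t + 1 = j.val → ∀ r, moveLeft (extend x) j.val t r =
      x j (r + ((j.val - k.val - 1 : ℕ) : ZMod n)) *
        (sigmaBar x k j ((n - 1) * (j.val - k.val - 1)) r /
          sigmaBar x k j ((n - 1) * (j.val - k.val - 1)) (r - 1)) := by
  induction t with
  | zero =>
    intro k hk r
    have h0 : j.val - k.val - 1 = 0 := by omega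
    simp [moveLeft, extend_val, h0, sigmaBar_zero]
  | succ t ih =>
    intro k hk r
    have hqm : k.val + 1 < m := by omega
    set q : Fin m := ⟨k.val + 1, hqm⟩ with hq
    have hqv : q.val = k.val + 1 := rfl
    have hu := ih q (by omega)
    set u := moveLeft (extend x) j.val t with hudef
    have hκ : ∀ r, kappa (x q) u r =
        sigmaBar x k j ((n - 1) * (j.val - k.val - 1)) (r - 1) /
          sigmaBar x q j ((n - 1) * (j.val - q.val - 1)) r := by
      intro r
      rw [kappa_eq, sigmaBar_pred x (NeZero.pos n) hqv (by rw [Fin.lt_def]; omega), sum_div]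
      refine sum_congr rfl fun l hl => ?_
      have hl := mem_range.1 hl
      rw [descProd_of_left_formula hx hu,
        show (n - 1) * (j.val - q.val - 1) + (n - 1 - l) =
          (n - 1) * (j.val - q.val - 1) + (n - 1) - l by omega,
        show r - (l : ZMod n) - 1 - ((n - 1 - l : ℕ) : ZMod n) = r by
          rw [Nat.cast_sub (by omega), Nat.cast_sub (by omega)]
          simp
          ring,
        show r - 1 - (l : ZMod n) = r - l - 1 by ring]
      ring
    rw [moveLeft, ← hudef, extend_eq x (q := q) (by omega)]
    simp only [eta]
    rw [hκ, hκ, hu]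
    have e1 : r + 1 + ((j.val - q.val - 1 : ℕ) : ZMod n) =
        r + ((j.val - k.val - 1 : ℕ) : ZMod n) := by
      rw [show j.val - k.val - 1 = (j.val - q.val - 1) + 1 by omega]
      push_cast
      ring
    rw [e1, add_sub_cancel_right]
    have h1 := (sigmaBar_pos hx q j ((n - 1) * (j.val - q.val - 1)) r).ne'
    have h2 := (sigmaBar_pos hx q j ((n - 1) * (j.val - q.val - 1)) (r + 1)).ne'
    have h3 := (sigmaBar_pos hx k j ((n - 1) * (j.val - k.val - 1)) (r - 1)).ne'
    field_simp

/-- Up to the normalizations of the two moved vectors, `Ω_k` is `κ` of `x_i` moved right to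
position `k` and `x_j` moved left to position `k + 1`. -/
theorem kappa_moveRight_moveLeft (hx : ∀ p r, 0 < x p r) {i k j : Fin m} (hik : i ≤ k)
    (hkj : k < j) (r : ZMod n) :
    kappa (moveRight (extend x) i.val (k.val - i.val))
        (moveLeft (extend x) j.val (j.val - k.val - 1)) r =
      Omega x i k j (r - 1 - ((k.val - i.val : ℕ) : ZMod n)) /
        (sigma x i k ((n - 1) * (k.val - i.val)) (r - 1 - ((k.val - i.val : ℕ) : ZMod n)) *
          sigmaBar x k j ((n - 1) * (j.val - k.val - 1)) r) := by
  have hik' : i.val ≤ k.val := hik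
  have hkj' : k.val < j.val := hkj
  rw [kappa_eq, Omega, sum_div]
  refine sum_congr rfl fun l hl => ?_
  have hl := mem_range.1 hl
  have hD : (n - 1) * (j.val - k.val) = (n - 1) * (j.val - k.val - 1) + (n - 1) := by
    rw [← Nat.mul_succ]
    congr 1
    omega
  rw [descProd_of_right_formula hx (moveRight_formula hx i (k.val - i.val) k (by omega)),
    descProd_of_left_formula hx (moveLeft_formula hx j (j.val - k.val - 1) k (by omega)),
    show r - (l : ZMod n) - 1 - ((n - 1 - l : ℕ) : ZMod n) = r by
      rw [Nat.cast_sub (by omega), Nat.cast_sub (by omega)]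
      simp
      ring,
    show r - 1 - ((k.val - i.val : ℕ) : ZMod n) + (k.val : ZMod n) - (i.val : ZMod n) - l =
        r - l - 1 by
      rw [Nat.cast_sub hik']
      ring,
    hD, Nat.add_sub_assoc (by omega : l ≤ n - 1)]
  rw [div_mul_div_comm]

/-- The vector `x_j` moved left past `x_{j-1}, …, x_{k+1}` and then past `x_i` moved right to
position `k`. -/
theorem eta_moveRight_moveLeft_fst (hx : ∀ p r, 0 < x p r) {i k j : Fin m} (hik : i ≤ k)
    (hkj : k < j) (r : ZMod n) :
    (eta (moveRight (extend x) i.val (k.val - i.val))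
        (moveLeft (extend x) j.val (j.val - k.val - 1))).1 r =
      x j (r + j.val - k.val) *
        (Omega x i k j (r - k.val + i.val) / Omega x i k j (r - k.val + i.val - 1)) *
        (sigma x i k ((n - 1) * (k.val - i.val)) (r - k.val + i.val - 1) /
          sigma x i k ((n - 1) * (k.val - i.val)) (r - k.val + i.val)) := by
  have hik' : i.val ≤ k.val := hik
  have hkj' : k.val < j.val := hkj
  simp only [eta]
  rw [kappa_moveRight_moveLeft hx hik hkj, kappa_moveRight_moveLeft hx hik hkj,
    moveLeft_formula hx j (j.val - k.val - 1) k (by omega)]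
  have e1 : r + 1 + ((j.val - k.val - 1 : ℕ) : ZMod n) = r + j.val - k.val := by
    rw [Nat.sub_sub, Nat.cast_sub (by omega)]
    push_cast
    ring
  have e2 : r + 1 - 1 - ((k.val - i.val : ℕ) : ZMod n) = r - k.val + i.val := by
    rw [Nat.cast_sub hik']
    ring
  have e3 : r - 1 - ((k.val - i.val : ℕ) : ZMod n) = r - k.val + i.val - 1 := by
    rw [Nat.cast_sub hik']
    ring
  rw [e1, e2, e3, add_sub_cancel_right]
  have h1 := (sigma_pos hx i k ((n - 1) * (k.val - i.val)) (r - k.val + i.val)).ne'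
  have h2 := (sigma_pos hx i k ((n - 1) * (k.val - i.val)) (r - k.val + i.val - 1)).ne'
  have h3 := (sigmaBar_pos hx k j ((n - 1) * (j.val - k.val - 1)) r).ne'
  have h4 := (sigmaBar_pos hx k j ((n - 1) * (j.val - k.val - 1)) (r + 1)).ne'
  have h5 := (Omega_pos (NeZero.pos n) hx i k j (r - k.val + i.val - 1)).ne'
  field_simp

/-- The coordinates of the `k`-th vector: the two mixed products preserved by `η` express it through
moved vectors, whose normalizations by `sigma` and whose factors `x_i`, `x_j` cancel. -/
theorem wordAct_transWord_formula (hx : ∀ p r, 0 < x p r) {i k j : Fin m} (hik : i < k)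
    (hkj : k < j) (r : ZMod n) :
    wordAct (transWord i.val j.val) x k r =
      x k r *
        ((Omega x i k j (r - k.val + i.val) * Omega x i (prev k) j (r - k.val + i.val - 1)) /
          (Omega x i (prev k) j (r - k.val + i.val) * Omega x i k j (r - k.val + i.val - 1))) := by
  have hik' : i.val < k.val := hik
  have hkj' : k.val < j.val := hkj
  have hX := extend_pos hx
  have hpv : (prev k).val = k.val - 1 := rfl
  have hip : i ≤ prev k := by rw [Fin.le_def]; omega
  have hpj : prev k < j := by rw [Fin.lt_def]; omega
  have hcast : ((prev k).val : ZMod n) = k.val - 1 := by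
    rw [hpv, Nat.cast_sub (by omega), Nat.cast_one]
  set w := moveRight (extend x) i.val (k.val - 1 - i.val) with hw
  set w' := moveRight (extend x) i.val (k.val - i.val) with hw'
  set u := moveLeft (extend x) j.val (j.val - k.val - 1) with hu
  have hww' : w' = (eta w (x k)).2 := by
    rw [hw', show k.val - i.val = k.val - 1 - i.val + 1 by omega, moveRight, ← hw,
      extend_eq x (q := k) (by omega)]
  have hu' : moveLeft (extend x) j.val (j.val - (prev k).val - 1) = (eta (x k) u).1 := by
    rw [show j.val - (prev k).val - 1 = j.val - k.val - 1 + 1 by omega, moveLeft, ← hu,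
      extend_eq x (q := k) (by omega)]
  have hwpos : ∀ r, 0 < w r := moveRight_pos hX _ _
  have hupos : ∀ r, 0 < u r := moveLeft_pos hX _ _
  have hwpos' : ∀ r, 0 < w' r := moveRight_pos hX _ _
  have hy : wordAct (transWord i.val j.val) x k = (eta (eta w (x k)).1 (eta w' u).1).2 := by
    have hd : i.val + (j.val - i.val - 1) + 1 = j.val := by omega
    have h := (extend_wordAct_transWord (d := j.val - i.val - 1) x hx
      (by omega : i.val + (j.val - i.val - 1) + 1 < m)).2.1 (k.val - 1 - i.val) (by omega)
    rw [hd, extend_eq _ (q := k) (by omega), extend_eq x (q := k) (by omega), ← hw,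
      show k.val - 1 - i.val + 1 = k.val - i.val by omega, ← hw',
      show j.val - i.val - 1 - (k.val - 1 - i.val) - 1 = j.val - k.val - 1 by omega, ← hu] at h
    exact h
  have hpos1 := eta_fst_pos hwpos (hx k)
  have hpos2 := eta_fst_pos hwpos' hupos
  -- The two mixed products determine `y_k` from the moved vectors.
  have m1 := eta_mul hpos1 hpos2 r
  have m2 := eta_mul hwpos (hx k) r
  have hyb : (eta (eta w (x k)).1 (eta w' u).1).1 = (eta w (eta (x k) u).1).1 := by
    rw [hww']
    exact eta_yangBaxter_fst hwpos (hx k) hupos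
  have f1 := eta_moveRight_moveLeft_fst hx hik.le hkj r
  have f2 := eta_moveRight_moveLeft_fst hx hip hpj (r - 1)
  have g1 := moveRight_formula hx i (k.val - i.val) k (by omega) r
  have g2 := moveRight_formula hx i (k.val - 1 - i.val) (prev k) (by omega) (r - 1)
  rw [hu', hpv, ← hw, ← hpv, hcast] at f2
  rw [← hw', ← hu] at f1
  rw [← hw', Nat.cast_sub hik'.le] at g1
  rw [← hw, Nat.cast_sub (by omega), Nat.cast_sub (by omega), Nat.cast_one] at g2
  rw [hyb, ← hy, f1, f2] at m1
  rw [← hww', g1, g2] at m2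
  have e1 : r - 1 + (j.val : ZMod n) - (k.val - 1) = r + j.val - k.val := by ring
  have e2 : r - 1 - ((k.val : ZMod n) - 1) + i.val = r - k.val + i.val := by ring
  have e3 : r - ((k.val : ZMod n) - i.val) = r - k.val + i.val := by ring
  have e4 : r - 1 - ((k.val : ZMod n) - 1 - i.val) = r - k.val + i.val := by ring
  rw [e1, e2] at m1
  rw [e3, e4] at m2
  have hΩ := fun k r => Omega_pos (NeZero.pos n) hx i k j r
  have hσ := fun k d r => sigma_pos hx i k d r
  have h1 := hΩ k (r - k.val + i.val)
  have h2 := hΩ k (r - k.val + i.val - 1)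
  have h3 := hΩ (prev k) (r - k.val + i.val)
  have h4 := hΩ (prev k) (r - k.val + i.val - 1)
  have h5 := hσ k ((n - 1) * (k.val - i.val)) (r - k.val + i.val)
  have h6 := hσ k ((n - 1) * (k.val - i.val)) (r - k.val + i.val - 1)
  have h7 := hσ (prev k) ((n - 1) * ((prev k).val - i.val)) (r - k.val + i.val)
  have h8 := hσ (prev k) ((n - 1) * ((prev k).val - i.val)) (r - k.val + i.val - 1)
  have h9 := hx i (r - k.val + i.val)
  have h10 := hx j (r + j.val - k.val)
  generalize Omega x i k j (r - k.val + i.val) = Ω1 at *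
  generalize Omega x i k j (r - k.val + i.val - 1) = Ω2 at *
  generalize Omega x i (prev k) j (r - k.val + i.val) = Ω3 at *
  generalize Omega x i (prev k) j (r - k.val + i.val - 1) = Ω4 at *
  generalize sigma x i k ((n - 1) * (k.val - i.val)) (r - k.val + i.val) = S1 at *
  generalize sigma x i k ((n - 1) * (k.val - i.val)) (r - k.val + i.val - 1) = S2 at *
  generalize sigma x i (prev k) ((n - 1) * ((prev k).val - i.val)) (r - k.val + i.val) = S3 at *
  generalize sigma x i (prev k) ((n - 1) * ((prev k).val - i.val)) (r - k.val + i.val - 1) = S4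
    at *
  generalize x i (r - k.val + i.val) = A at *
  generalize x j (r + j.val - k.val) = B at *
  generalize (eta w (x k)).1 (r - 1) = C at *
  generalize wordAct (transWord i.val j.val) x k r = y at *
  generalize x k r = z at *
  have hC : C = S4 * S1 / (S3 * S2) * z := by
    field_simp at m2 ⊢
    linear_combination m2
  rw [hC] at m1
  field_simp at m1 ⊢
  linear_combination m1

end Formulas

end BirationalR
end

theorem mainTheorem2 (n m : ℕ) (hn : 0 < n) (x : Fin m → ZMod n → ℝ)
    (hx : ∀ p r, 0 < x p r) (i k j : Fin m) (hik : i < k) (hkj : k < j) (r : ZMod n) :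
    BirationalR.wordPerm (BirationalR.transWord i.val j.val) = Equiv.swap i j ∧
    0 < BirationalR.Omega x i (BirationalR.prev k) j (r - (k.val : ZMod n) + (i.val : ZMod n)) ∧
    0 < BirationalR.Omega x i k j (r - (k.val : ZMod n) + (i.val : ZMod n) - 1) ∧
    BirationalR.wordAct (BirationalR.transWord i.val j.val) x k r =
      x k r *
        ((BirationalR.Omega x i k j (r - (k.val : ZMod n) + (i.val : ZMod n)) *
            BirationalR.Omega x i (BirationalR.prev k) j
              (r - (k.val : ZMod n) + (i.val : ZMod n) - 1)) /
          (BirationalR.Omega x i (BirationalR.prev k) j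
              (r - (k.val : ZMod n) + (i.val : ZMod n)) *
            BirationalR.Omega x i k j
              (r - (k.val : ZMod n) + (i.val : ZMod n) - 1))) := by
  have : NeZero n := ⟨hn.ne'⟩
  refine ⟨?_, BirationalR.Omega_pos hn hx _ _ _ _, BirationalR.Omega_pos hn hx _ _ _ _,
    BirationalR.wordAct_transWord_formula hx hik hkj r⟩
  have hij : i.val < j.val := hik.trans hkj
  obtain ⟨d, hd⟩ := Nat.exists_eq_add_of_lt hij
  have h := BirationalR.wordPerm_transWord (m := m) (d := d) (i := i.val) (hd ▸ j.isLt)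
  have hj : (⟨i.val + d + 1, hd ▸ j.isLt⟩ : Fin m) = j := Fin.ext hd.symm
  rw [hj] at h
  rw [hd]
  exact h
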